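/- Graphs are finite, undirected, without loops or multiple edges. For vertices $u,v$ of a graph $X$ let $d_X(u,v)\in\mathbb{N}\cup\{\infty\}$ be the least number of edges of an edge-path from $u$ to $v$ ($\infty$ if there is none). Let $Z_X$ be the matrix over $\mathbb{Z}[[q]]$ with entries $Z_X(u,v)=q^{d_X(u,v)}$, where $q^\infty=0$; it is invertible, and the magnitude of $X$ is $\mathrm{Mag}(X)=\sum_{u,v}Z_X^{-1}(u,v)\in\mathbb{Z}[[q]]$. A generalized Whitney twist $(G,H,K,\alpha)$ consists of graphs $G,H,K$, inclusions $\iota_G:K\to G$ and $\iota_H:K\to H$ of $K$ as an induced subgraph, and an isometry $\alpha:K\to K$ (a vertex map preserving $d_K$). From it form the graph $X$ by gluing $G\sqcup H$ along $\iota_G(k)\sim\iota_H(k)$, and the graph $Y$ by gluing $G\sqcup H$ along $\iota_G(k)\sim\iota_H(\alpha(k))$, for all $k\in K$, merging double edges. A vertex $h$ of $H$ projects to $K$ if $h$ is connected in $H$ by an edge-path to some vertex of $K$ and there is $\pi(h)\in K$ with $d_H(h,k)=d_H(h,\pi(h))+d_H(\pi(h),k)$ for all $k\in K$. The twist is a sycamore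 twist if (i) $K$ is convex in both $X$ and $Y$, i.e. $d_X(k,k')=d_K(k,k')=d_Y(k,k')$ for all $k,k'\in K$, where $k\in K$ is regarded as the vertex $\iota_G(k)$ of $X$ and of $Y$; and (ii) every vertex $h$ of $H$ that does not project to $K$ satisfies $d_H(h,k)=d_H(h,\alpha(k))$ for all $k\in K$. Two graphs differ by a sycamore twist if they are isomorphic to the graphs $X$ and $Y$ formed from some sycamore twist. They differ by a Whitney twist if there are graphs $G$, $H$ with distinct vertices $g_+\ne g_-$ of $G$ and $h_+\neq h_-$ of $H$ such that, up to isomorphism, the first is obtained from $G\sqcup H$ by identifying $g_\pm$ with $h_\pm$, the second by identifying $g_\pm$ with $h_\mp$, merging double edges. **Theorem.** If graphs $X$ and $Y$ differ by a sycamore twist, then $\mathrm{Mag}(X)=\mathrm{Mag}(Y)$ in $\mathbb{Z}[[q]]$. This properly generalises Leinster's invariance of magnitude under Whitney twists along adjacent gluing vertices: any two graphs that differ by a Whitney twist whose two gluing vertices are adjacent also differ by a sycamore twist, and there exist non-isomorphic graphs that differ by a sycamore twist but do not differ by any Whitney twist. -/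

import Mathlib

universe u v w

namespace GraphTwist

/-! ### Magnitude of a finite graph -/

/-- `q ^ n` in `ℤ⟦q⟧` for an extended natural number `n`, with `q ^ ∞ = 0`. -/
noncomputable def qPow (n : ℕ∞) : PowerSeries ℤ :=
  if n = ⊤ then 0 else (PowerSeries.X : PowerSeries ℤ) ^ n.toNat

/-- The matrix `Z_X` with entries `q ^ d(u, v)`; here `edist` is the shortest-path distance,
equal to `∞` when no edge-path exists. -/
noncomputable def simMatrix {V : Type v} (X : SimpleGraph V) : Matrix V V (PowerSeries ℤ) :=
  Matrix.of fun a b => qPow (X.edist a b)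

open Classical in
/-- The matrix inverse in the definition of magnitude is a genuine two-sided inverse. -/
theorem isUnit_det_simMatrix {V : Type v} [Fintype V] (X : SimpleGraph V) :
    IsUnit (simMatrix X).det := by
  have h : (simMatrix X).map (PowerSeries.constantCoeff (R := ℤ)) = 1 := by
    ext a b
    by_cases hab : a = b
    · subst hab
      simp [simMatrix, qPow]
    · have h0 : X.edist a b ≠ 0 := fun h => hab (SimpleGraph.edist_eq_zero_iff.mp h)
      by_cases ht : X.edist a b = ⊤
      · simp [simMatrix, qPow, ht, hab]
      · have h1 : (X.edist a b).toNat ≠ 0 := by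
          intro h
          rcases (ENat.toNat_eq_zero).mp h with h | h
          · exact h0 h
          · exact ht h
        simp [simMatrix, qPow, ht, hab, h1]
  rw [PowerSeries.isUnit_iff_constantCoeff, RingHom.map_det]
  have h2 : (PowerSeries.constantCoeff (R := ℤ)).mapMatrix (simMatrix X) = 1 := h
  rw [h2]
  simp

open Classical in
/-- The magnitude of a finite graph: the sum of all entries of `Z_X⁻¹`. -/
noncomputable def magnitude {V : Type v} [Fintype V] (X : SimpleGraph V) : PowerSeries ℤ :=
  ∑ a : V, ∑ b : V, (simMatrix X)⁻¹ a b

/-! ### Gluing of graphs -/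

/-- The vertex set of a gluing: the disjoint union of `V` and `W`, with `f k` and `g k`
identified for each `k`. -/
def GlueVertex {κ : Type u} {V : Type v} {W : Type w} (f : κ → V) (g : κ → W) :
    Type (max v w) :=
  Quot fun a b : V ⊕ W => ∃ k : κ, a = Sum.inl (f k) ∧ b = Sum.inr (g k)

/-- The vertex of the gluing represented by a vertex of the first graph. -/
def GlueVertex.inl {κ : Type u} {V : Type v} {W : Type w} (f : κ → V) (g : κ → W) (a : V) :
    GlueVertex f g :=
  Quot.mk _ (Sum.inl a)

/-- The vertex of the gluing represented by a vertex of the second graph. -/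
def GlueVertex.inr {κ : Type u} {V : Type v} {W : Type w} (f : κ → V) (g : κ → W) (b : W) :
    GlueVertex f g :=
  Quot.mk _ (Sum.inr b)

/-- The gluing of `G` and `H` which identifies `f k` with `g k` for each `k`: two vertices are
adjacent when they are joined by an edge coming from `G` or by an edge coming from `H`. (Being an
adjacency relation, this merges double edges. The condition `a ≠ b` discards loops; when `f` and
`g` are injective none arise.) -/
def glue {κ : Type u} {V : Type v} {W : Type w} (G : SimpleGraph V) (H : SimpleGraph W)
    (f : κ → V) (g : κ → W) : SimpleGraph (GlueVertex f g) where
  Adj a b := a ≠ b ∧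
    ((∃ s t : V, G.Adj s t ∧ a = GlueVertex.inl f g s ∧ b = GlueVertex.inl f g t) ∨
      ∃ s t : W, H.Adj s t ∧ a = GlueVertex.inr f g s ∧ b = GlueVertex.inr f g t)
  symm := ⟨by
    rintro a b ⟨hab, ⟨s, t, h, ha, hb⟩ | ⟨s, t, h, ha, hb⟩⟩
    · exact ⟨hab.symm, Or.inl ⟨t, s, h.symm, hb, ha⟩⟩
    · exact ⟨hab.symm, Or.inr ⟨t, s, h.symm, hb, ha⟩⟩⟩
  loopless := ⟨fun _ h => h.1 rfl⟩

/-! ### Whitney twists -/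

/-- `X` and `Y` differ (up to isomorphism of graphs) by a Whitney twist: `X` glues `G` and `H`
by identifying `g₁` with `h₁` and `g₂` with `h₂`, while `Y` identifies `g₁` with `h₂` and `g₂`
with `h₁`. -/
def DifferByWhitneyTwist {V : Type v} {W : Type w} (X : SimpleGraph V) (Y : SimpleGraph W) :
    Prop :=
  ∃ (A B : Type u) (_ : Finite A) (_ : Finite B) (G : SimpleGraph A) (H : SimpleGraph B)
    (g₁ g₂ : A) (h₁ h₂ : B), g₁ ≠ g₂ ∧ h₁ ≠ h₂ ∧
    Nonempty (X ≃g glue G H ![g₁, g₂] ![h₁, h₂]) ∧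
    Nonempty (Y ≃g glue G H ![g₁, g₂] ![h₂, h₁])

/-- `X` and `Y` differ (up to isomorphism of graphs) by a Whitney twist whose two gluing vertices
are adjacent in `X`. -/
def DifferByAdjacentWhitneyTwist {V : Type v} {W : Type w} (X : SimpleGraph V)
    (Y : SimpleGraph W) : Prop :=
  ∃ (A B : Type u) (_ : Finite A) (_ : Finite B) (G : SimpleGraph A) (H : SimpleGraph B)
    (g₁ g₂ : A) (h₁ h₂ : B), g₁ ≠ g₂ ∧ h₁ ≠ h₂ ∧
    (glue G H ![g₁, g₂] ![h₁, h₂]).Adj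
      (GlueVertex.inl ![g₁, g₂] ![h₁, h₂] g₁) (GlueVertex.inl ![g₁, g₂] ![h₁, h₂] g₂) ∧
    Nonempty (X ≃g glue G H ![g₁, g₂] ![h₁, h₂]) ∧
    Nonempty (Y ≃g glue G H ![g₁, g₂] ![h₂, h₁])

/-! ### Generalized Whitney twists and sycamore twists -/

/-- A vertex map which preserves the (extended) shortest-path distance. -/
def IsIsometric {V : Type v} {W : Type w} (A : SimpleGraph V) (B : SimpleGraph W)
    (φ : V → W) : Prop :=
  ∀ s t : V, B.edist (φ s) (φ t) = A.edist s t

/-- The vertex `h` of `H` projects to the subgraph which is the image of `ι`: it is connected by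
an edge-path to some vertex of the image, and there is a vertex `π(h) = ι p` in the image through
which all distances from `h` to the image are measured. -/
def ProjectsTo {κ : Type u} {W : Type w} (H : SimpleGraph W) (ι : κ → W) (h : W) : Prop :=
  (∃ k : κ, H.Reachable h (ι k)) ∧
    ∃ p : κ, ∀ k : κ, H.edist h (ι k) = H.edist h (ι p) + H.edist (ι p) (ι k)

/-- A generalized Whitney twist `(G, H, K, α)`: finite graphs `G`, `H`, `K`, inclusions of `K`
as an induced subgraph of `G` and of `H`, and an isometry `α : K → K`. -/
structure Twist where
  VG : Type u
  VH : Type u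
  VK : Type u
  finG : Finite VG
  finH : Finite VH
  finK : Finite VK
  G : SimpleGraph VG
  H : SimpleGraph VH
  K : SimpleGraph VK
  ιG : K ↪g G
  ιH : K ↪g H
  α : VK → VK
  isometric : IsIsometric K K α

namespace Twist

/-- The graph `X` of the twist: `ιG k` is identified with `ιH k`. -/
def X (T : Twist.{u}) : SimpleGraph (GlueVertex T.ιG T.ιH) :=
  glue T.G T.H T.ιG T.ιH

/-- The graph `Y` of the twist: `ιG k` is identified with `ιH (α k)`. -/
def Y (T : Twist.{u}) : SimpleGraph (GlueVertex T.ιG (fun k => T.ιH (T.α k))) :=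
  glue T.G T.H T.ιG (fun k => T.ιH (T.α k))

/-- A sycamore twist: `K` is convex in `X` and in `Y` (its inclusion is isometric), and every
vertex of `H` which does not project to `K` is equidistant in `H` from `k` and `α k`,
for each `k` in `K`. -/
structure IsSycamore (T : Twist.{u}) : Prop where
  convex_X : IsIsometric T.K T.X fun k => GlueVertex.inl T.ιG T.ιH (T.ιG k)
  convex_Y : IsIsometric T.K T.Y
    fun k => GlueVertex.inl T.ιG (fun k => T.ιH (T.α k)) (T.ιG k)
  equidistant : ∀ h : T.VH, ¬ ProjectsTo T.H T.ιH h →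
    ∀ k : T.VK, T.H.edist h (T.ιH k) = T.H.edist h (T.ιH (T.α k))

end Twist

/-- `X` and `Y` differ (up to isomorphism of graphs) by a sycamore twist. -/
def DifferBySycamoreTwist {V : Type v} {W : Type w} (X : SimpleGraph V) (Y : SimpleGraph W) :
    Prop :=
  ∃ T : Twist.{u}, T.IsSycamore ∧ Nonempty (X ≃g T.X) ∧ Nonempty (Y ≃g T.Y)

end GraphTwist

/-! Magnitude is `1ᵀ Z⁻¹ 1`. For invertible `E` this equals `(1ᵀE)(EᵀZE)⁻¹(1ᵀE)ᵀ`, so two similarity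
matrices have the same magnitude once congruences with equal column sums carry them to the same
matrix (`sum_inv_eq_of_colOp`).

Convexity of `K` makes the metrics of `G` and `H` agree on the glued vertices. Hence both graphs sit
isometrically in each gluing, and a mixed distance is an infimum over `K` (`glue_edist_inl`,
`glue_edist_inr_inr`). If `h` projects to `K`, every distance from `G` to `h` runs through `π(h)`,
so subtracting `q ^ d(h, π(h))` times the column of `π(h)` clears the entries between `G` and `h` in
both gluings. If `h` does not project, equidistance makes those entries equal from the start. The
entries among vertices of `H` involve only the metric of `H`, and so do the multipliers, so the
column sums agree as well (`magnitude_glue_eq`).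

For a Whitney twist along an edge, distances to the two ends differ by at most one: a vertex either
projects to an end or is equidistant. The example that is not a Whitney twist glues along a
triangle: no two vertices separate `exampleX`, so its Whitney twists are trivial, while degrees
distinguish it from `exampleY`. -/

namespace GraphTwist

/-! ### Vertices of a gluing -/

section GlueVertex

variable {κ : Type u} {V : Type v} {W : Type w} {f : κ → V} {g : κ → W}

theorem GlueVertex.inl_eq_inr (k : κ) :
    GlueVertex.inl f g (f k) = GlueVertex.inr f g (g k) :=
  Quot.sound ⟨k, rfl, rfl⟩

open Classical in
/-- The representative of a vertex of a gluing, chosen in the first graph whenever possible. -/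
noncomputable def GlueVertex.split (hg : Function.Injective g) :
    GlueVertex f g → V ⊕ {b : W // b ∉ Set.range g} :=
  Quot.lift
    (Sum.elim Sum.inl fun b =>
      if h : b ∈ Set.range g then Sum.inl (f h.choose) else Sum.inr ⟨b, h⟩)
    (by
      rintro a b ⟨k, rfl, rfl⟩
      have h : g k ∈ Set.range g := ⟨k, rfl⟩
      have h2 : h.choose = k := hg h.choose_spec
      simp only [Sum.elim_inl, Sum.elim_inr, dif_pos h, h2])

theorem GlueVertex.split_inl (hg : Function.Injective g) (a : V) :
    GlueVertex.split hg (GlueVertex.inl f g a) = Sum.inl a := rfl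

theorem GlueVertex.split_inr (hg : Function.Injective g) {b : W} (hb : b ∉ Set.range g) :
    GlueVertex.split hg (GlueVertex.inr f g b) = Sum.inr ⟨b, hb⟩ :=
  dif_neg hb

theorem GlueVertex.split_inr_range (hg : Function.Injective g) (k : κ) :
    GlueVertex.split hg (GlueVertex.inr f g (g k)) = Sum.inl (f k) := by
  rw [← GlueVertex.inl_eq_inr, GlueVertex.split_inl]

theorem GlueVertex.ind {P : GlueVertex f g → Prop} (hl : ∀ a, P (GlueVertex.inl f g a))
    (hr : ∀ b, P (GlueVertex.inr f g b)) (x : GlueVertex f g) : P x :=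
  Quot.ind (fun s => Sum.rec hl hr s) x

theorem GlueVertex.inl_injective (hg : Function.Injective g) :
    Function.Injective (GlueVertex.inl f g) := fun a a' h => by
  simpa [GlueVertex.split_inl] using congrArg (GlueVertex.split hg) h

/-- Equality of classes could a priori come from a long chain of identifications; the invariant
`split` shows that injectivity of `g` leaves only direct ones. -/
theorem GlueVertex.exists_of_inl_eq_inr (hg : Function.Injective g) {a : V} {b : W}
    (h : GlueVertex.inl f g a = GlueVertex.inr f g b) : ∃ k, a = f k ∧ b = g k := by
  have h1 := congrArg (GlueVertex.split hg) h
  by_cases hb : b ∈ Set.range g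
  · obtain ⟨k, rfl⟩ := hb
    rw [GlueVertex.split_inl, GlueVertex.split_inr_range] at h1
    exact ⟨k, Sum.inl_injective h1, rfl⟩
  · rw [GlueVertex.split_inl, GlueVertex.split_inr hg hb] at h1
    cases h1

theorem GlueVertex.inr_injective (hf : Function.Injective f) (hg : Function.Injective g) :
    Function.Injective (GlueVertex.inr f g) := fun b b' h => by
  by_cases hb : b ∈ Set.range g
  · obtain ⟨k, rfl⟩ := hb
    rw [← GlueVertex.inl_eq_inr] at h
    obtain ⟨k', h1, rfl⟩ := GlueVertex.exists_of_inl_eq_inr hg h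
    rw [hf h1]
  · by_cases hb' : b' ∈ Set.range g
    · obtain ⟨k, rfl⟩ := hb'
      rw [← GlueVertex.inl_eq_inr] at h
      obtain ⟨k', h1, rfl⟩ := GlueVertex.exists_of_inl_eq_inr hg h.symm
      rw [hf h1]
    · have h1 := congrArg (GlueVertex.split hg) h
      rw [GlueVertex.split_inr hg hb, GlueVertex.split_inr hg hb'] at h1
      exact congrArg Subtype.val (Sum.inr_injective h1)

/-- The vertices of a gluing are those of the first graph and the unglued ones of the second. -/
noncomputable def GlueVertex.equiv (hg : Function.Injective g) {S : Set W}
    (hS : Set.range g = S) : V ⊕ {b : W // b ∉ S} ≃ GlueVertex f g where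
  toFun := Sum.elim (GlueVertex.inl f g) fun b => GlueVertex.inr f g b
  invFun x := Sum.map id (fun b : {b : W // b ∉ Set.range g} => ⟨b.1, hS ▸ b.2⟩)
    (GlueVertex.split hg x)
  left_inv := by
    subst hS
    rintro (a | b)
    · simp [GlueVertex.split_inl]
    · simp [GlueVertex.split_inr hg b.2]
  right_inv := by
    subst hS
    intro x
    induction x using GlueVertex.ind with
    | hl a => simp [GlueVertex.split_inl]
    | hr b =>
      by_cases hb : b ∈ Set.range g
      · obtain ⟨k, rfl⟩ := hb
        simp [GlueVertex.split_inr_range, GlueVertex.inl_eq_inr]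
      · simp [GlueVertex.split_inr hg hb]

end GlueVertex

/-! ### Shortest-path distances -/

section Distance

variable {V : Type v} {W : Type w}

theorem edist_le_edist_add_one {G : SimpleGraph V} {s t : V} (h : G.Adj s t) (a : V) :
    G.edist a s ≤ G.edist a t + 1 := by
  have h1 := G.edist_triangle (u := a) (v := t) (w := s)
  rwa [SimpleGraph.edist_eq_one_iff_adj.mpr h.symm] at h1

/-- Lower bounds on distances come from `1`-Lipschitz potentials, so shortest paths in a gluing need
never be cut into pieces. -/
theorem le_add_edist_of_forall_adj {G : SimpleGraph V} {φ : V → ℕ∞}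
    (h : ∀ s t, G.Adj s t → φ s ≤ φ t + 1) (x y : V) : φ x ≤ φ y + G.edist x y := by
  by_cases ht : G.edist x y = ⊤
  · simp [ht]
  · obtain ⟨p, hp⟩ := SimpleGraph.exists_walk_of_edist_ne_top ht
    rw [← hp]
    clear hp ht
    induction p with
    | nil => simp
    | cons hadj p ih =>
      refine (h _ _ hadj).trans ((add_le_add_left ih 1).trans ?_)
      simp [add_assoc]

theorem edist_map_le {G : SimpleGraph V} {H : SimpleGraph W} {φ : V → W}
    (h : ∀ s t, G.Adj s t → H.Adj (φ s) (φ t)) (x y : V) :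
    H.edist (φ x) (φ y) ≤ G.edist x y := by
  have := le_add_edist_of_forall_adj (φ := fun z => H.edist (φ y) (φ z))
    (fun s t hst => edist_le_edist_add_one (h s t hst) _) x y
  simpa [H.edist_comm (u := φ x)] using this

end Distance

/-! ### Distances in a gluing -/

section GlueDistance

variable {κ : Type u} {V : Type v} {W : Type w} {f : κ → V} {g : κ → W}
  {G : SimpleGraph V} {H : SimpleGraph W}

theorem glue_adj_inl (hg : Function.Injective g) {s t : V} (h : G.Adj s t) :
    (glue G H f g).Adj (GlueVertex.inl f g s) (GlueVertex.inl f g t) :=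
  ⟨fun he => h.ne (GlueVertex.inl_injective hg he), Or.inl ⟨s, t, h, rfl, rfl⟩⟩

theorem glue_adj_inr (hf : Function.Injective f) (hg : Function.Injective g) {s t : W}
    (h : H.Adj s t) :
    (glue G H f g).Adj (GlueVertex.inr f g s) (GlueVertex.inr f g t) :=
  ⟨fun he => h.ne (GlueVertex.inr_injective hf hg he), Or.inr ⟨s, t, h, rfl, rfl⟩⟩

theorem glue_edist_inl_le (hg : Function.Injective g) (a a' : V) :
    (glue G H f g).edist (GlueVertex.inl f g a) (GlueVertex.inl f g a') ≤ G.edist a a' :=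
  edist_map_le (fun _ _ h => glue_adj_inl hg h) a a'

theorem glue_edist_inr_le (hf : Function.Injective f) (hg : Function.Injective g) (b b' : W) :
    (glue G H f g).edist (GlueVertex.inr f g b) (GlueVertex.inr f g b') ≤ H.edist b b' :=
  edist_map_le (fun _ _ h => glue_adj_inr hf hg h) b b'

/-- Functions on the two graphs which agree on glued vertices and are `1`-Lipschitz along edges
give lower bounds for distances in the gluing. -/
theorem exists_lipschitz_glue {φ : V → ℕ∞} {ψ : W → ℕ∞} (hc : ∀ k, φ (f k) = ψ (g k))
    (hφ : ∀ s t, G.Adj s t → φ s ≤ φ t + 1) (hψ : ∀ s t, H.Adj s t → ψ s ≤ ψ t + 1) :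
    ∃ Φ : GlueVertex f g → ℕ∞, (∀ a, Φ (GlueVertex.inl f g a) = φ a) ∧
      (∀ b, Φ (GlueVertex.inr f g b) = ψ b) ∧
      ∀ x y, Φ x ≤ Φ y + (glue G H f g).edist x y := by
  refine ⟨Quot.lift (Sum.elim φ ψ) ?_, fun _ => rfl, fun _ => rfl,
    le_add_edist_of_forall_adj ?_⟩
  · rintro a b ⟨k, rfl, rfl⟩
    exact hc k
  · rintro x y ⟨-, ⟨s, t, h, rfl, rfl⟩ | ⟨s, t, h, rfl, rfl⟩⟩
    · exact hφ s t h
    · exact hψ s t h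

theorem iInf_add_edist_le_add_one {s t : W} (h : H.Adj s t) (c : κ → ℕ∞) :
    (⨅ k, (c k + H.edist (g k) s)) ≤ (⨅ k, (c k + H.edist (g k) t)) + 1 := by
  rw [ENat.iInf_add]
  exact iInf_mono fun k => by
    rw [add_assoc]
    exact add_le_add_right (edist_le_edist_add_one h _) _

/-- If the two metrics agree on the glued vertices, then distances from a vertex of the first
graph are computed by passing through the glued vertices. -/
theorem glue_edist_inl (hf : Function.Injective f) (hg : Function.Injective g)
    (hd : ∀ k k', G.edist (f k) (f k') = H.edist (g k) (g k')) (a : V) :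
    (∀ a', (glue G H f g).edist (GlueVertex.inl f g a) (GlueVertex.inl f g a') = G.edist a a') ∧
    ∀ b, (glue G H f g).edist (GlueVertex.inl f g a) (GlueVertex.inr f g b) =
      ⨅ k, (G.edist a (f k) + H.edist (g k) b) := by
  -- The potential is the expected distance from `a`. Its two halves match on glued vertices by `hd`
  -- and the triangle inequality in `G`.
  obtain ⟨Φ, h1, h2, h3⟩ := exists_lipschitz_glue (f := f) (g := g) (G := G) (H := H)
    (φ := G.edist a) (ψ := fun b => ⨅ k, (G.edist a (f k) + H.edist (g k) b))
    (fun k => by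
      refine le_antisymm (le_iInf fun k' => ?_) (iInf_le_of_le k (by simp))
      rw [← hd]
      exact G.edist_triangle)
    (fun s t h => edist_le_edist_add_one h a)
    (fun s t h => iInf_add_edist_le_add_one h _)
  have h4 : ∀ x, Φ x ≤ (glue G H f g).edist (GlueVertex.inl f g a) x := fun x => by
    have := h3 x (GlueVertex.inl f g a)
    rwa [h1, SimpleGraph.edist_self, zero_add, SimpleGraph.edist_comm] at this
  refine ⟨fun a' => le_antisymm (glue_edist_inl_le hg a a') (h1 a' ▸ h4 _), fun b => ?_⟩
  refine le_antisymm (le_iInf fun k => ?_) ((h2 b).symm.le.trans (h4 _))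
  refine ((glue G H f g).edist_triangle (v := GlueVertex.inl f g (f k))).trans ?_
  refine add_le_add (glue_edist_inl_le hg _ _) ?_
  rw [GlueVertex.inl_eq_inr]
  exact glue_edist_inr_le hf hg _ _

/-- A detour through `G` between glued vertices cannot be shorter than the distance in `H`, by `hd`.
The potential is the distance from `b`, extended over `G` by an infimum. -/
theorem glue_edist_inr_inr (hf : Function.Injective f) (hg : Function.Injective g)
    (hd : ∀ k k', G.edist (f k) (f k') = H.edist (g k) (g k')) (b b' : W) :
    (glue G H f g).edist (GlueVertex.inr f g b) (GlueVertex.inr f g b') = H.edist b b' := by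
  obtain ⟨Φ, -, h2, h3⟩ := exists_lipschitz_glue (f := f) (g := g) (G := G) (H := H)
    (φ := fun a => ⨅ k, (H.edist b (g k) + G.edist (f k) a)) (ψ := H.edist b)
    (fun k => by
      refine le_antisymm (iInf_le_of_le k (by simp)) (le_iInf fun k' => ?_)
      rw [hd]
      exact H.edist_triangle)
    (fun s t h => iInf_add_edist_le_add_one h _)
    (fun s t h => edist_le_edist_add_one h b)
  refine le_antisymm (glue_edist_inr_le hf hg b b') ?_
  have := h3 (GlueVertex.inr f g b') (GlueVertex.inr f g b)
  rwa [h2, h2, SimpleGraph.edist_self, zero_add,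
    (glue G H f g).edist_comm] at this

/-- A convex inclusion of the glued vertices makes the two metrics agree on them. -/
theorem edist_eq_of_convex (hf : Function.Injective f) (hg : Function.Injective g)
    {K : SimpleGraph κ}
    (hfK : ∀ k k', K.Adj k k' → G.Adj (f k) (f k'))
    (hgK : ∀ k k', H.edist (g k) (g k') ≤ K.edist k k')
    (hK : IsIsometric K (glue G H f g) fun k => GlueVertex.inl f g (f k)) (k k' : κ) :
    G.edist (f k) (f k') = K.edist k k' ∧ H.edist (g k) (g k') = K.edist k k' := by
  -- Both metrics are squeezed between the distance in `K` and the distance in the gluing, which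
  -- convexity makes equal.
  refine ⟨le_antisymm (edist_map_le hfK k k') ?_, le_antisymm (hgK k k') ?_⟩
  · rw [← hK k k']
    exact glue_edist_inl_le hg _ _
  · rw [← hK k k']
    simp only [GlueVertex.inl_eq_inr]
    exact glue_edist_inr_le hf hg _ _

end GlueDistance

/-! ### Sums of the entries of an inverse matrix -/

section Matrices

variable {V : Type v} {R : Type w} [Fintype V] [DecidableEq V] [CommRing R]

/-- The sum of the entries of the inverse is unchanged by congruences preserving the all-ones
vector. -/
theorem sum_inv_eq_of_congruence {Z Z' E F : Matrix V V R} (hZ : IsUnit Z.det)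
    (hZ' : IsUnit Z'.det) (hE : IsUnit E.det) (hF : IsUnit F.det)
    (h : E.transpose * Z * E = F.transpose * Z' * F)
    (h1 : Matrix.vecMul 1 E = Matrix.vecMul 1 F) :
    ∑ a, ∑ b, Z⁻¹ a b = ∑ a, ∑ b, Z'⁻¹ a b := by
  have key : ∀ {Z E : Matrix V V R}, IsUnit Z.det → IsUnit E.det →
      Z⁻¹ = E * (E.transpose * Z * E)⁻¹ * E.transpose := by
    intro Z E hZ hE
    have hEt : IsUnit E.transpose.det := by rwa [Matrix.det_transpose]
    rw [Matrix.mul_inv_rev, Matrix.mul_inv_rev, ← mul_assoc, ← mul_assoc,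
      Matrix.mul_nonsing_inv _ hE, one_mul, mul_assoc, Matrix.nonsing_inv_mul _ hEt, mul_one]
  have sum_eq : ∀ M : Matrix V V R,
      ∑ a, ∑ b, M a b = dotProduct (Matrix.vecMul 1 M) 1 := fun M => by
    simp only [dotProduct, Matrix.vecMul, Pi.one_apply, one_mul, mul_one]
    exact Finset.sum_comm
  have key2 : ∀ {Z E : Matrix V V R}, IsUnit Z.det → IsUnit E.det →
      ∑ a, ∑ b, Z⁻¹ a b =
        dotProduct (Matrix.vecMul (Matrix.vecMul 1 E) (E.transpose * Z * E)⁻¹)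
          (Matrix.vecMul 1 E) := fun {Z E} hZ hE => by
    rw [sum_eq, key hZ hE, ← Matrix.vecMul_vecMul, ← Matrix.vecMul_vecMul,
      ← Matrix.dotProduct_mulVec, Matrix.mulVec_transpose]
  rw [key2 hZ hE, key2 hZ' hF, h, h1]

/-- The elementary column operation subtracting `t v` times column `ρ v` from column `v`. -/
def colOp (t : V → R) (ρ : V → V) : Matrix V V R :=
  1 - Matrix.of fun a b => if a = ρ b then t b else 0

theorem isUnit_det_colOp {t : V → R} {ρ : V → V} (h : ∀ v, t (ρ v) = 0) :
    IsUnit (colOp t ρ).det := by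
  -- Since `t` vanishes on the image of `ρ`, `N` squares to zero and `1 + N` inverts `1 - N`.
  set N : Matrix V V R := Matrix.of fun a b => if a = ρ b then t b else 0 with hN
  have hNN : N * N = 0 := by
    ext a b
    simp [hN, Matrix.mul_apply, h]
  have : colOp t ρ * (1 + N) = 1 := by
    rw [colOp, ← hN, sub_mul, one_mul, mul_add, hNN, mul_one, add_zero, add_sub_cancel_right]
  exact Matrix.isUnit_det_of_right_inverse this

theorem mul_colOp_apply (Z : Matrix V V R) (t : V → R) (ρ : V → V) (a b : V) :
    (Z * colOp t ρ) a b = Z a b - t b * Z a (ρ b) := by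
  rw [colOp, mul_sub, mul_one, Matrix.sub_apply]
  simp [Matrix.mul_apply, mul_comm]

theorem congruence_colOp_apply (Z : Matrix V V R) (t : V → R) (ρ : V → V) (a b : V) :
    ((colOp t ρ).transpose * Z * colOp t ρ) a b =
      (Z a b - t b * Z a (ρ b)) - t a * (Z (ρ a) b - t b * Z (ρ a) (ρ b)) := by
  rw [mul_assoc, ← Matrix.transpose_transpose (Z * colOp t ρ), ← Matrix.transpose_mul,
    Matrix.transpose_apply, mul_colOp_apply]
  simp only [Matrix.transpose_apply, mul_colOp_apply]

/-- The column sums do not depend on `ρ`, so the two gluings may send `h` to different positions as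
long as the multipliers agree. -/
theorem vecMul_one_colOp (t : V → R) (ρ : V → V) :
    Matrix.vecMul 1 (colOp t ρ) = 1 - t := by
  ext v
  simp [colOp, Matrix.vecMul, dotProduct, Matrix.one_apply]

theorem sum_inv_eq_of_colOp {Z Z' : Matrix V V R} (hZ : IsUnit Z.det) (hZ' : IsUnit Z'.det)
    {t : V → R} {ρ ρ' : V → V} (hρ : ∀ v, t (ρ v) = 0) (hρ' : ∀ v, t (ρ' v) = 0)
    (h : ∀ a b, (Z a b - t b * Z a (ρ b)) - t a * (Z (ρ a) b - t b * Z (ρ a) (ρ b)) =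
      (Z' a b - t b * Z' a (ρ' b)) - t a * (Z' (ρ' a) b - t b * Z' (ρ' a) (ρ' b))) :
    ∑ a, ∑ b, Z⁻¹ a b = ∑ a, ∑ b, Z'⁻¹ a b := by
  refine sum_inv_eq_of_congruence hZ hZ' (isUnit_det_colOp hρ) (isUnit_det_colOp hρ') ?_ ?_
  · ext a b : 2
    simp only [congruence_colOp_apply, h]
  · simp only [vecMul_one_colOp]

end Matrices

/-! ### Magnitude of a sycamore twist -/

/-- Turns additivity of distances through a projection into proportionality of matrix entries;
infinite distances fit because `0` absorbs. -/
theorem qPow_add (m n : ℕ∞) : qPow (m + n) = qPow m * qPow n := by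
  by_cases hm : m = ⊤
  · simp [qPow, hm]
  · by_cases hn : n = ⊤
    · simp [qPow, hn]
    · simp [qPow, hm, hn, ENat.toNat_add hm hn, pow_add]

theorem edist_iso {V : Type v} {W : Type w} {X : SimpleGraph V} {Y : SimpleGraph W} (e : X ≃g Y)
    (a b : V) : Y.edist (e a) (e b) = X.edist a b := by
  refine le_antisymm (edist_map_le (fun s t h => e.map_adj_iff.mpr h) a b) ?_
  have := edist_map_le (G := Y) (H := X) (φ := e.symm)
    (fun s t h => e.symm.map_adj_iff.mpr h) (e a) (e b)
  simpa using this

theorem magnitude_congr {V : Type v} {W : Type w} [Fintype V] [Fintype W] {X : SimpleGraph V}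
    {Y : SimpleGraph W} (e : X ≃g Y) : magnitude X = magnitude Y := by
  classical
  have h : simMatrix X = (simMatrix Y).submatrix e.toEquiv e.toEquiv := by
    ext1 a b
    exact congrArg qPow (edist_iso e a b).symm
  unfold magnitude
  refine Fintype.sum_equiv e.toEquiv _ _ fun a => Fintype.sum_equiv e.toEquiv _ _ fun b => ?_
  have h2 : (simMatrix X)⁻¹ = (simMatrix Y)⁻¹.submatrix e.toEquiv e.toEquiv := by
    rw [h, Matrix.inv_submatrix_equiv]
  have h3 := congrFun (congrFun h2 a) b
  rw [Matrix.submatrix_apply] at h3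
  convert h3

theorem IsIsometric.injective {V : Type v} {W : Type w} {A : SimpleGraph V} {B : SimpleGraph W}
    {φ : V → W} (h : IsIsometric A B φ) : Function.Injective φ := fun s t hst => by
  rw [← SimpleGraph.edist_eq_zero_iff (G := A), ← h, hst, SimpleGraph.edist_self]

section Projection

variable {κ : Type u} {V : Type v} {W : Type w} {f : κ → V} {g : κ → W}
  {G : SimpleGraph V} {H : SimpleGraph W}

/-- Distances from the first graph to a vertex which projects to the glued part go through its
projection. -/
theorem glue_edist_inl_inr_of_projection (hf : Function.Injective f) (hg : Function.Injective g)
    (hd : ∀ k k', G.edist (f k) (f k') = H.edist (g k) (g k')) {h : W} {p : κ}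
    (hp : ∀ k, H.edist h (g k) = H.edist h (g p) + H.edist (g p) (g k)) (a : V) :
    (glue G H f g).edist (GlueVertex.inl f g a) (GlueVertex.inr f g h) =
      (glue G H f g).edist (GlueVertex.inl f g a) (GlueVertex.inr f g (g p)) +
        H.edist h (g p) := by
  rw [(glue_edist_inl hf hg hd a).2, ← GlueVertex.inl_eq_inr, (glue_edist_inl hf hg hd a).1]
  refine le_antisymm (iInf_le_of_le p (by rw [H.edist_comm])) (le_iInf fun k => ?_)
  rw [H.edist_comm (u := g k), hp k, ← hd, add_comm (H.edist h (g p)), ← add_assoc]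
  refine add_le_add_left ?_ _
  rw [G.edist_comm (u := f p)]
  exact G.edist_triangle

end Projection

/-- Two gluings of the same graphs have the same magnitude if every vertex of the second graph
either has the same distances to the first graph in both gluings, or projects to the glued part
in both of them. -/
theorem magnitude_glue_eq {κ : Type u} {V : Type v} {W : Type w} {f f' : κ → V} {g g' : κ → W}
    {G : SimpleGraph V} {H : SimpleGraph W}
    [Fintype (GlueVertex f g)] [Fintype (GlueVertex f' g')]
    (hf : Function.Injective f) (hg : Function.Injective g)
    (hf' : Function.Injective f') (hg' : Function.Injective g')
    (hrange : Set.range g' = Set.range g)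
    (hd : ∀ k k', G.edist (f k) (f k') = H.edist (g k) (g k'))
    (hd' : ∀ k k', G.edist (f' k) (f' k') = H.edist (g' k) (g' k'))
    (hproj : ∀ h : W, (∃ p : κ, ∀ k, H.edist h (g k) = H.edist h (g p) + H.edist (g p) (g k)) ∨
      ∀ a, (glue G H f g).edist (GlueVertex.inl f g a) (GlueVertex.inr f g h) =
        (glue G H f' g').edist (GlueVertex.inl f' g' a) (GlueVertex.inr f' g' h)) :
    magnitude (glue G H f g) = magnitude (glue G H f' g') := by
  classical
  let I := V ⊕ {b : W // b ∉ Set.range g}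
  let e : I ≃ GlueVertex f g := GlueVertex.equiv hg rfl
  let e' : I ≃ GlueVertex f' g' := GlueVertex.equiv hg' hrange
  have : Fintype I := Fintype.ofEquiv _ e.symm
  have hX : magnitude ((glue G H f g).comap e) = magnitude (glue G H f g) :=
    magnitude_congr (SimpleGraph.Iso.comap e _)
  have hY : magnitude ((glue G H f' g').comap e') = magnitude (glue G H f' g') :=
    magnitude_congr (SimpleGraph.Iso.comap e' _)
  have dX : ∀ a b, ((glue G H f g).comap e).edist a b = (glue G H f g).edist (e a) (e b) :=
    fun a b => (edist_iso (SimpleGraph.Iso.comap e (glue G H f g)) a b).symm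
  have dY : ∀ a b, ((glue G H f' g').comap e').edist a b =
      (glue G H f' g').edist (e' a) (e' b) :=
    fun a b => (edist_iso (SimpleGraph.Iso.comap e' (glue G H f' g')) a b).symm
  -- Reachability is not needed here: at infinite distance the multiplier is zero and the identities
  -- still hold.
  let P : W → Prop := fun h =>
    ∃ p : κ, ∀ k, H.edist h (g k) = H.edist h (g p) + H.edist (g p) (g k)
  -- The projection is chosen as a vertex of `H`, and its property refers only to the range of `g`,
  -- so the same choice serves both gluings.
  have hex : ∀ h, ∃ k : W, P h → k ∈ Set.range g ∧
      ∀ k' ∈ Set.range g, H.edist h k' = H.edist h k + H.edist k k' := by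
    intro h
    by_cases hP : P h
    · obtain ⟨p, hp⟩ := hP
      refine ⟨g p, fun _ => ⟨⟨p, rfl⟩, ?_⟩⟩
      rintro _ ⟨k, rfl⟩
      exact hp k
    · exact ⟨h, fun h => absurd h hP⟩
  choose π hπ using hex
  let t : I → PowerSeries ℤ := Sum.elim 0 fun h => if P h then qPow (H.edist h (π h)) else 0
  let ρ : I → I := Sum.elim Sum.inl fun h =>
    if P h then e.symm (GlueVertex.inr f g (π h)) else Sum.inr h
  let ρ' : I → I := Sum.elim Sum.inl fun h =>
    if P h then e'.symm (GlueVertex.inr f' g' (π h)) else Sum.inr h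
  have el : ∀ a, e (Sum.inl a) = GlueVertex.inl f g a := fun _ => rfl
  have er : ∀ h, e (Sum.inr h) = GlueVertex.inr f g h := fun _ => rfl
  have el' : ∀ a, e' (Sum.inl a) = GlueVertex.inl f' g' a := fun _ => rfl
  have er' : ∀ h, e' (Sum.inr h) = GlueVertex.inr f' g' h := fun _ => rfl
  have tl : ∀ a, t (Sum.inl a) = 0 := fun _ => rfl
  have tP : ∀ h : {b : W // b ∉ Set.range g}, P h → t (Sum.inr h) = qPow (H.edist h (π h)) :=
    fun h hP => if_pos hP
  have tN : ∀ h : {b : W // b ∉ Set.range g}, ¬ P h → t (Sum.inr h) = 0 := fun h hP => if_neg hP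
  have ρP : ∀ h : {b : W // b ∉ Set.range g}, P h →
      e (ρ (Sum.inr h)) = GlueVertex.inr f g (π h) := fun h hP => by
    rw [show ρ (Sum.inr h) = e.symm (GlueVertex.inr f g (π h)) from if_pos hP,
      Equiv.apply_symm_apply]
  have ρP' : ∀ h : {b : W // b ∉ Set.range g}, P h →
      e' (ρ' (Sum.inr h)) = GlueVertex.inr f' g' (π h) := fun h hP => by
    rw [show ρ' (Sum.inr h) = e'.symm (GlueVertex.inr f' g' (π h)) from if_pos hP,
      Equiv.apply_symm_apply]
  have ρt : ∀ v, t (ρ v) = 0 := by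
    rintro (a | h)
    · rfl
    · by_cases hP : P h
      · obtain ⟨⟨k, hk⟩, -⟩ := hπ h hP
        have : ρ (Sum.inr h) = Sum.inl (f k) := by
          apply e.injective
          rw [ρP h hP, el, ← hk, GlueVertex.inl_eq_inr]
        rw [this, tl]
      · rw [show ρ (Sum.inr h) = Sum.inr h from if_neg hP, tN h hP]
  have ρt' : ∀ v, t (ρ' v) = 0 := by
    rintro (a | h)
    · rfl
    · by_cases hP : P h
      · obtain ⟨hk, -⟩ := hπ h hP
        obtain ⟨k, hk⟩ := hrange.ge hk
        have : ρ' (Sum.inr h) = Sum.inl (f' k) := by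
          apply e'.injective
          rw [ρP' h hP, el', ← hk, GlueVertex.inl_eq_inr]
        rw [this, tl]
      · rw [show ρ' (Sum.inr h) = Sum.inr h from if_neg hP, tN h hP]
  have zP : ∀ (a : V) (h : {b : W // b ∉ Set.range g}), P h →
      simMatrix ((glue G H f g).comap e) (Sum.inl a) (Sum.inr h) -
        t (Sum.inr h) * simMatrix ((glue G H f g).comap e) (Sum.inl a) (ρ (Sum.inr h)) = 0 := by
    intro a h hP
    obtain ⟨⟨p, hp⟩, hk⟩ := hπ h hP
    simp only [simMatrix, Matrix.of_apply, dX, ρP h hP, el, er, tP h hP, ← hp]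
    rw [glue_edist_inl_inr_of_projection hf hg hd (p := p)
      (fun k => by rw [hp]; exact hk _ ⟨k, rfl⟩) a, qPow_add, mul_comm, sub_self]
  have zP' : ∀ (a : V) (h : {b : W // b ∉ Set.range g}), P h →
      simMatrix ((glue G H f' g').comap e') (Sum.inl a) (Sum.inr h) -
        t (Sum.inr h) * simMatrix ((glue G H f' g').comap e') (Sum.inl a) (ρ' (Sum.inr h)) =
        0 := by
    intro a h hP
    obtain ⟨hp, hk⟩ := hπ h hP
    obtain ⟨p, hp⟩ := hrange.ge hp
    simp only [simMatrix, Matrix.of_apply, dY, ρP' h hP, el', er', tP h hP, ← hp]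
    rw [glue_edist_inl_inr_of_projection hf' hg' hd' (p := p)
      (fun k => by rw [hp]; exact hk _ (hrange.le ⟨k, rfl⟩)) a, qPow_add, mul_comm, sub_self]
  have zG : ∀ (a : V) (x : I),
      simMatrix ((glue G H f g).comap e) (Sum.inl a) x -
        t x * simMatrix ((glue G H f g).comap e) (Sum.inl a) (ρ x) =
      simMatrix ((glue G H f' g').comap e') (Sum.inl a) x -
        t x * simMatrix ((glue G H f' g').comap e') (Sum.inl a) (ρ' x) := by
    rintro a (a' | h)
    · simp only [tl, simMatrix, Matrix.of_apply, dX, dY, el, el', zero_mul,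
        (glue_edist_inl hf hg hd a).1, (glue_edist_inl hf' hg' hd' a).1]
    · by_cases hP : P h
      · rw [zP a h hP, zP' a h hP]
      · have := (hproj h).resolve_left hP a
        simp only [tN h hP, simMatrix, Matrix.of_apply, dX, dY, el, el', er, er', zero_mul, this]
  have sX : ∀ x y, simMatrix ((glue G H f g).comap e) x y =
      simMatrix ((glue G H f g).comap e) y x := fun x y => by
    simp only [simMatrix, Matrix.of_apply, SimpleGraph.edist_comm]
  have sY : ∀ x y, simMatrix ((glue G H f' g').comap e') x y =
      simMatrix ((glue G H f' g').comap e') y x := fun x y => by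
    simp only [simMatrix, Matrix.of_apply, SimpleGraph.edist_comm]
  have main : ∑ a, ∑ b, (simMatrix ((glue G H f g).comap e))⁻¹ a b =
      ∑ a, ∑ b, (simMatrix ((glue G H f' g').comap e'))⁻¹ a b := by
    have hu : ∀ Z : SimpleGraph I, IsUnit (simMatrix Z).det := fun Z => by
      convert isUnit_det_simMatrix Z
    refine sum_inv_eq_of_colOp (t := t) (ρ := ρ) (ρ' := ρ') (hu _) (hu _) ρt ρt' ?_
    rintro (a | h) (a' | h')
    · simp only [tl, zero_mul, sub_zero]
      simpa only [tl, zero_mul, sub_zero] using zG a (Sum.inl a')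
    · simp only [tl, zero_mul, sub_zero]
      exact zG a (Sum.inr h')
    · simp only [tl, zero_mul, sub_zero]
      rw [sX _ (Sum.inl a'), sX _ (Sum.inl a'), sY _ (Sum.inl a'), sY _ (Sum.inl a')]
      exact zG a' (Sum.inr h)
    -- All four entries are distances between vertices of `H`, hence the same in both gluings.
    · by_cases hP : P h <;> by_cases hP' : P h'
      all_goals
        simp only [simMatrix, Matrix.of_apply, dX, dY, er, er', glue_edist_inr_inr hf hg hd,
          glue_edist_inr_inr hf' hg' hd', tN _, ρP _, ρP' _, hP, hP', not_false_eq_true, zero_mul]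
  rw [← hX, ← hY]
  unfold magnitude
  convert main

/-- Magnitude is invariant under sycamore twists. -/
theorem Twist.IsSycamore.magnitude_eq {T : Twist.{u}} (hT : T.IsSycamore)
    [Fintype (GlueVertex T.ιG T.ιH)] [Fintype (GlueVertex T.ιG fun k => T.ιH (T.α k))] :
    magnitude T.X = magnitude T.Y := by
  have := T.finK
  -- Bijectivity of `α` ensures that both gluings use the same set of vertices of `H`.
  have hα : Function.Bijective T.α :=
    Finite.injective_iff_bijective.mp T.isometric.injective
  have hd := edist_eq_of_convex (f := T.ιG) (g := T.ιH) T.ιG.injective T.ιH.injective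
    (fun k k' h => T.ιG.map_adj_iff.mpr h)
    (edist_map_le fun k k' h => T.ιH.map_adj_iff.mpr h) hT.convex_X
  have hgY : Function.Injective fun k => T.ιH (T.α k) := T.ιH.injective.comp hα.1
  have hd' := edist_eq_of_convex (f := T.ιG) (g := fun k => T.ιH (T.α k)) T.ιG.injective hgY
    (fun k k' h => T.ιG.map_adj_iff.mpr h)
    (fun k k' => (edist_map_le (fun k k' h => T.ιH.map_adj_iff.mpr h) _ _).trans
      (T.isometric k k').le) hT.convex_Y
  have hdX := fun k k' => (hd k k').1.trans (hd k k').2.symm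
  have hdY := fun k k' => (hd' k k').1.trans (hd' k k').2.symm
  refine magnitude_glue_eq T.ιG.injective T.ιH.injective T.ιG.injective hgY
    (hα.2.range_comp T.ιH) hdX hdY fun h => ?_
  by_cases hP : ProjectsTo T.H T.ιH h
  · exact Or.inl hP.2
  · refine Or.inr fun a => ?_
    rw [(glue_edist_inl T.ιG.injective T.ιH.injective hdX a).2,
      (glue_edist_inl T.ιG.injective hgY hdY a).2]
    refine iInf_congr fun k => ?_
    rw [SimpleGraph.edist_comm (u := T.ιH k), hT.equidistant h hP k,
      SimpleGraph.edist_comm (u := h)]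

theorem DifferBySycamoreTwist.magnitude_eq {V : Type v} {W : Type w} [Fintype V] [Fintype W]
    {X : SimpleGraph V} {Y : SimpleGraph W} (h : DifferBySycamoreTwist.{u} X Y) :
    magnitude X = magnitude Y := by
  obtain ⟨T, hT, ⟨eX⟩, ⟨eY⟩⟩ := h
  have := Fintype.ofEquiv _ eX.toEquiv
  have := Fintype.ofEquiv _ eY.toEquiv
  rw [magnitude_congr eX, magnitude_congr eY, hT.magnitude_eq]

/-! ### Isomorphisms of gluings -/

section GlueIso

variable {κ : Type*} {κ' : Type*} {V V' W W' : Type*} {f : κ → V} {g : κ → W}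
  {f' : κ' → V'} {g' : κ' → W'}

/-- A gluing of `G` and `H` is isomorphic to any graph which is covered by copies of `G` and `H`
meeting exactly in the glued vertices. -/
theorem nonempty_iso_glue {U : Type*} {Z : SimpleGraph U} {G : SimpleGraph V} {H : SimpleGraph W}
    (i : V → U) (j : W → U) (hi : Function.Injective i) (hj : Function.Injective j)
    (hij : ∀ k, i (f k) = j (g k)) (hij' : ∀ a b, i a = j b → ∃ k, a = f k ∧ b = g k)
    (hsurj : ∀ x, (∃ a, i a = x) ∨ ∃ b, j b = x)
    (hadj : ∀ x y, Z.Adj x y ↔ (∃ s t, G.Adj s t ∧ x = i s ∧ y = i t) ∨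
      ∃ s t, H.Adj s t ∧ x = j s ∧ y = j t) :
    Nonempty (Z ≃g glue G H f g) := by
  let φ : GlueVertex f g → U := Quot.lift (Sum.elim i j) (by
    rintro a b ⟨k, rfl, rfl⟩
    exact hij k)
  have hl : ∀ a, φ (GlueVertex.inl f g a) = i a := fun _ => rfl
  have hr : ∀ b, φ (GlueVertex.inr f g b) = j b := fun _ => rfl
  have hlr : ∀ a b, i a = j b → GlueVertex.inl f g a = GlueVertex.inr f g b := by
    intro a b h
    obtain ⟨k, rfl, rfl⟩ := hij' a b h
    exact GlueVertex.inl_eq_inr k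
  have hinj : Function.Injective φ := by
    intro x y h
    induction x using GlueVertex.ind with
    | hl a =>
      induction y using GlueVertex.ind with
      | hl a' => rw [hi h]
      | hr b' => exact hlr _ _ h
    | hr b =>
      induction y using GlueVertex.ind with
      | hl a' => exact (hlr _ _ h.symm).symm
      | hr b' => rw [hj h]
  have hsur : Function.Surjective φ := fun x => by
    rcases hsurj x with ⟨a, rfl⟩ | ⟨b, rfl⟩
    exacts [⟨GlueVertex.inl f g a, hl a⟩, ⟨GlueVertex.inr f g b, hr b⟩]
  let e : GlueVertex f g ≃ U := Equiv.ofBijective φ ⟨hinj, hsur⟩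
  refine ⟨(⟨e, ?_⟩ : glue G H f g ≃g Z).symm⟩
  intro x y
  change Z.Adj (φ x) (φ y) ↔ _
  constructor
  · intro h
    refine ⟨fun hxy => h.ne (congrArg φ hxy), ?_⟩
    rcases (hadj _ _).mp h with ⟨s, t, hst, hx, hy⟩ | ⟨s, t, hst, hx, hy⟩
    · exact Or.inl ⟨s, t, hst, hinj hx, hinj hy⟩
    · exact Or.inr ⟨s, t, hst, hinj hx, hinj hy⟩
  · rintro ⟨-, ⟨s, t, hst, rfl, rfl⟩ | ⟨s, t, hst, rfl, rfl⟩⟩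
    · exact (hadj _ _).mpr (Or.inl ⟨s, t, hst, rfl, rfl⟩)
    · exact (hadj _ _).mpr (Or.inr ⟨s, t, hst, rfl, rfl⟩)

/-- Gluing is functorial for isomorphisms compatible with the glued vertices. -/
theorem nonempty_glue_iso_glue {G : SimpleGraph V} {H : SimpleGraph W} {G' : SimpleGraph V'}
    {H' : SimpleGraph W'} (φ : G ≃g G') (ψ : H ≃g H') (σ : κ ≃ κ')
    (hf : Function.Injective f) (hg : Function.Injective g)
    (hφ : ∀ k, φ (f k) = f' (σ k)) (hψ : ∀ k, ψ (g k) = g' (σ k)) :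
    Nonempty (glue G H f g ≃g glue G' H' f' g') := by
  refine nonempty_iso_glue (fun a => GlueVertex.inl f g (φ.symm a))
    (fun b => GlueVertex.inr f g (ψ.symm b))
    ((GlueVertex.inl_injective hg).comp φ.symm.injective)
    ((GlueVertex.inr_injective hf hg).comp ψ.symm.injective) ?_ ?_ ?_ ?_
  · intro k
    have h1 : φ.symm (f' k) = f (σ.symm k) := by
      rw [RelIso.symm_apply_eq, hφ, Equiv.apply_symm_apply]
    have h2 : ψ.symm (g' k) = g (σ.symm k) := by
      rw [RelIso.symm_apply_eq, hψ, Equiv.apply_symm_apply]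
    simp only [h1, h2, GlueVertex.inl_eq_inr]
  · intro a b h
    obtain ⟨k, h1, h2⟩ := GlueVertex.exists_of_inl_eq_inr hg h
    exact ⟨σ k, by rw [← hφ, ← h1, RelIso.apply_symm_apply],
      by rw [← hψ, ← h2, RelIso.apply_symm_apply]⟩
  · intro x
    induction x using GlueVertex.ind with
    | hl a => exact Or.inl ⟨φ a, by rw [RelIso.symm_apply_apply]⟩
    | hr b => exact Or.inr ⟨ψ b, by rw [RelIso.symm_apply_apply]⟩
  · intro x y
    constructor
    · rintro ⟨-, ⟨s, t, hst, rfl, rfl⟩ | ⟨s, t, hst, rfl, rfl⟩⟩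
      · exact Or.inl ⟨φ s, φ t, φ.map_adj_iff.mpr hst, by simp, by simp⟩
      · exact Or.inr ⟨ψ s, ψ t, ψ.map_adj_iff.mpr hst, by simp, by simp⟩
    · rintro (⟨s, t, hst, rfl, rfl⟩ | ⟨s, t, hst, rfl, rfl⟩)
      · exact glue_adj_inl hg (φ.symm.map_adj_iff.mpr hst)
      · exact glue_adj_inr hf hg (ψ.symm.map_adj_iff.mpr hst)

end GlueIso

/-! ### Whitney twists along adjacent vertices -/

theorem vecCons_pair_injective {A : Type*} {a b : A} (h : a ≠ b) :
    Function.Injective ![a, b] := by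
  intro i j hij
  fin_cases i <;> fin_cases j <;> simp_all

/-- An edge between the glued vertices may come from one side only. Adding it to both sides leaves
the gluing unchanged and makes the pair a clique in each graph. -/
theorem glue_sup_edge {κ : Type*} {V W : Type*} {f : κ → V} {g : κ → W} {G : SimpleGraph V}
    {H : SimpleGraph W} {a a' : V} {b b' : W} (hf : Function.Injective f)
    (hg : Function.Injective g) (hne : a ≠ a') (hne' : b ≠ b')
    (h : (GlueVertex.inl f g a = GlueVertex.inr f g b ∧
      GlueVertex.inl f g a' = GlueVertex.inr f g b') ∨
      (GlueVertex.inl f g a = GlueVertex.inr f g b' ∧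
      GlueVertex.inl f g a' = GlueVertex.inr f g b))
    (hadj : G.Adj a a' ∨ H.Adj b b') :
    glue (G ⊔ SimpleGraph.edge a a') (H ⊔ SimpleGraph.edge b b') f g = glue G H f g := by
  have hZ : (glue G H f g).Adj (GlueVertex.inl f g a) (GlueVertex.inl f g a') := by
    rcases hadj with h1 | h1
    · exact glue_adj_inl hg h1
    · have := glue_adj_inr (G := G) (f := f) (g := g) hf hg h1
      rcases h with ⟨h2, h3⟩ | ⟨h2, h3⟩
      · rwa [h2, h3]
      · rw [h2, h3]
        exact this.symm
  have hZ' : (glue G H f g).Adj (GlueVertex.inr f g b) (GlueVertex.inr f g b') := by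
    rcases h with ⟨h2, h3⟩ | ⟨h2, h3⟩
    · rwa [← h2, ← h3]
    · rw [← h2, ← h3]
      exact hZ.symm
  ext x y
  constructor
  · rintro ⟨-, ⟨s, t, hst, rfl, rfl⟩ | ⟨s, t, hst, rfl, rfl⟩⟩
    · rcases hst with hst | hst
      · exact glue_adj_inl hg hst
      · rw [SimpleGraph.edge_adj] at hst
        rcases hst with ⟨⟨rfl, rfl⟩ | ⟨rfl, rfl⟩, -⟩
        exacts [hZ, hZ.symm]
    · rcases hst with hst | hst
      · exact glue_adj_inr hf hg hst
      · rw [SimpleGraph.edge_adj] at hst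
        rcases hst with ⟨⟨rfl, rfl⟩ | ⟨rfl, rfl⟩, -⟩
        exacts [hZ', hZ'.symm]
  · rintro ⟨-, ⟨s, t, hst, rfl, rfl⟩ | ⟨s, t, hst, rfl, rfl⟩⟩
    · exact glue_adj_inl hg (Or.inl hst)
    · exact glue_adj_inr hf hg (Or.inl hst)

/-- The inclusion of a complete graph given by a family of pairwise adjacent vertices. -/
def topEmbedding {κ V : Type*} {G : SimpleGraph V} (f : κ → V)
    (h : ∀ k k', k ≠ k' → G.Adj (f k) (f k')) : (⊤ : SimpleGraph κ) ↪g G where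
  toFun := f
  inj' k k' hk := by
    by_contra hne
    exact (h k k' hne).ne hk
  map_rel_iff' {k k'} := by
    rw [SimpleGraph.top_adj]
    exact ⟨fun hadj hk => hadj.ne (congrArg f hk), h k k'⟩

/-- The inclusion of a complete graph is isometric. -/
theorem isIsometric_top {κ V : Type*} {G : SimpleGraph V} {f : κ → V}
    (h : ∀ k k', k ≠ k' → G.Adj (f k) (f k')) : IsIsometric (⊤ : SimpleGraph κ) G f := by
  intro k k'
  by_cases hk : k = k'
  · simp [hk]
  · rw [SimpleGraph.edist_eq_one_iff_adj.mpr (h k k' hk), SimpleGraph.edist_top_of_ne hk]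

/-- The twist of two graphs along a clique. -/
def cliqueTwist {κ V W : Type u} [Finite κ] [Finite V] [Finite W] {G : SimpleGraph V}
    {H : SimpleGraph W} (f : κ → V) (g : κ → W) (hf : ∀ k k', k ≠ k' → G.Adj (f k) (f k'))
    (hg : ∀ k k', k ≠ k' → H.Adj (g k) (g k')) (σ : Equiv.Perm κ) : Twist.{u} where
  VG := V
  VH := W
  VK := κ
  finG := inferInstance
  finH := inferInstance
  finK := inferInstance
  G := G
  H := H
  K := ⊤
  ιG := topEmbedding f hf
  ιH := topEmbedding g hg
  α := σ
  isometric := isIsometric_top fun _ _ hk => σ.injective.ne hk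

theorem isSycamore_cliqueTwist {κ V W : Type u} [Finite κ] [Finite V] [Finite W]
    {G : SimpleGraph V} {H : SimpleGraph W} {f : κ → V} {g : κ → W}
    {hf : ∀ k k', k ≠ k' → G.Adj (f k) (f k')} {hg : ∀ k k', k ≠ k' → H.Adj (g k) (g k')}
    {σ : Equiv.Perm κ}
    (h : ∀ b, (∃ p, H.Reachable b (g p) ∧
        ∀ k, H.edist b (g k) = H.edist b (g p) + H.edist (g p) (g k)) ∨
      ∀ k, H.edist b (g k) = H.edist b (g (σ k))) :
    (cliqueTwist f g hf hg σ).IsSycamore where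
  convex_X := isIsometric_top fun k k' hk =>
    glue_adj_inl (topEmbedding g hg).injective (hf k k' hk)
  convex_Y := isIsometric_top fun k k' hk =>
    glue_adj_inl ((topEmbedding g hg).injective.comp σ.injective) (hf k k' hk)
  equidistant b hb := (h b).resolve_left fun ⟨p, h1, h2⟩ => hb ⟨⟨p, h1⟩, p, h2⟩

theorem edist_projects_or_eq {W : Type*} {H : SimpleGraph W} {c d : W} (h : H.Adj c d) (b : W) :
    (H.Reachable b c ∧ H.edist b d = H.edist b c + 1) ∨ H.edist b c = H.edist b d ∨
      (H.Reachable b d ∧ H.edist b c = H.edist b d + 1) := by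
  have h1 := edist_le_edist_add_one h b
  have h2 := edist_le_edist_add_one h.symm b
  by_cases hc : H.Reachable b c
  · have hd : H.Reachable b d := hc.trans h.reachable
    rw [← hc.coe_dist_eq_edist, ← hd.coe_dist_eq_edist] at *
    norm_cast at *
    have : H.dist b d = H.dist b c + 1 ∨ H.dist b c = H.dist b d ∨
      H.dist b c = H.dist b d + 1 := by omega
    tauto
  · have hd : ¬ H.Reachable b d := fun hd => hc (hd.trans h.symm.reachable)
    rw [SimpleGraph.edist_eq_top_of_not_reachable hc, SimpleGraph.edist_eq_top_of_not_reachable hd]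
    exact Or.inr (Or.inl rfl)

theorem DifferByAdjacentWhitneyTwist.differBySycamoreTwist {V : Type v} {W : Type w}
    {X : SimpleGraph V} {Y : SimpleGraph W} (h : DifferByAdjacentWhitneyTwist.{u} X Y) :
    DifferBySycamoreTwist.{u} X Y := by
  obtain ⟨A, B, _, _, G, H, g₁, g₂, h₁, h₂, hg, hh, hadj, ⟨eX⟩, ⟨eY⟩⟩ := h
  have ig := vecCons_pair_injective hg
  have ih := vecCons_pair_injective hh
  have ih' := vecCons_pair_injective hh.symm
  have hadj' : G.Adj g₁ g₂ ∨ H.Adj h₁ h₂ := by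
    rcases hadj with ⟨-, ⟨s, t, hst, h1, h2⟩ | ⟨s, t, hst, h1, h2⟩⟩
    · rw [GlueVertex.inl_injective ih h1, GlueVertex.inl_injective ih h2]
      exact Or.inl hst
    · have h1' : h₁ = s := GlueVertex.inr_injective ig ih
        ((GlueVertex.inl_eq_inr (f := ![g₁, g₂]) (g := ![h₁, h₂]) 0).symm.trans h1)
      have h2' : h₂ = t := GlueVertex.inr_injective ig ih
        ((GlueVertex.inl_eq_inr (f := ![g₁, g₂]) (g := ![h₁, h₂]) 1).symm.trans h2)
      rw [h1', h2']
      exact Or.inr hst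
  let G' := G ⊔ SimpleGraph.edge g₁ g₂
  let H' := H ⊔ SimpleGraph.edge h₁ h₂
  have hX : glue G' H' ![g₁, g₂] ![h₁, h₂] = glue G H ![g₁, g₂] ![h₁, h₂] :=
    glue_sup_edge ig ih hg hh
      (Or.inl ⟨GlueVertex.inl_eq_inr (f := ![g₁, g₂]) (g := ![h₁, h₂]) 0,
        GlueVertex.inl_eq_inr (f := ![g₁, g₂]) (g := ![h₁, h₂]) 1⟩) hadj'
  have hY : glue G' H' ![g₁, g₂] ![h₂, h₁] = glue G H ![g₁, g₂] ![h₂, h₁] :=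
    glue_sup_edge ig ih' hg hh
      (Or.inr ⟨GlueVertex.inl_eq_inr (f := ![g₁, g₂]) (g := ![h₂, h₁]) 0,
        GlueVertex.inl_eq_inr (f := ![g₁, g₂]) (g := ![h₂, h₁]) 1⟩) hadj'
  have aG : G'.Adj g₁ g₂ := Or.inr (by simp [SimpleGraph.edge_adj, hg])
  have aH : H'.Adj h₁ h₂ := Or.inr (by simp [SimpleGraph.edge_adj, hh])
  have hcl : ∀ {D : Type u} {F : SimpleGraph D} {c d : D}, F.Adj c d →
      ∀ k k' : ULift.{u} (Fin 2), k ≠ k' → F.Adj (![c, d] k.down) (![c, d] k'.down) := by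
    rintro D F c d hF ⟨k⟩ ⟨k'⟩ hk
    fin_cases k <;> fin_cases k' <;> simp_all [SimpleGraph.adj_comm]
  let σ : Equiv.Perm (ULift.{u} (Fin 2)) :=
    Equiv.ulift.trans ((Equiv.swap 0 1).trans Equiv.ulift.symm)
  refine ⟨cliqueTwist (fun k => ![g₁, g₂] k.down) (fun k => ![h₁, h₂] k.down) (hcl aG) (hcl aH) σ,
    isSycamore_cliqueTwist fun b => ?_, ?_, ?_⟩
  · have a1 : H'.edist h₁ h₂ = 1 := SimpleGraph.edist_eq_one_iff_adj.mpr aH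
    have a2 : H'.edist h₂ h₁ = 1 := SimpleGraph.edist_eq_one_iff_adj.mpr aH.symm
    -- A vertex strictly nearer to one end projects to that end; otherwise exchanging the ends
    -- preserves its distances.
    rcases edist_projects_or_eq aH b with ⟨h1, h2⟩ | h1 | ⟨h1, h2⟩
    · refine Or.inl ⟨⟨0⟩, h1, ?_⟩
      rintro ⟨k⟩
      fin_cases k <;> simp [a1, h2]
    · refine Or.inr ?_
      rintro ⟨k⟩
      fin_cases k <;> simp [σ, h1]
    · refine Or.inl ⟨⟨1⟩, h1, ?_⟩
      rintro ⟨k⟩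
      fin_cases k <;> simp [a2, h2]
  · rw [← hX] at eX
    obtain ⟨e⟩ := nonempty_glue_iso_glue (f' := fun k : ULift.{u} (Fin 2) => ![g₁, g₂] k.down)
      (g' := fun k : ULift.{u} (Fin 2) => ![h₁, h₂] k.down) (RelIso.refl _ : G' ≃g G')
      (RelIso.refl _ : H' ≃g H') Equiv.ulift.symm ig ih (fun k => rfl) (fun k => rfl)
    exact ⟨eX.trans e⟩
  · rw [← hY] at eY
    obtain ⟨e⟩ := nonempty_glue_iso_glue (f' := fun k : ULift.{u} (Fin 2) => ![g₁, g₂] k.down)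
      (g' := fun k : ULift.{u} (Fin 2) => ![h₁, h₂] (σ k).down) (RelIso.refl _ : G' ≃g G')
      (RelIso.refl _ : H' ≃g H') Equiv.ulift.symm ig ih' (fun k => rfl)
      (fun k => by fin_cases k <;> rfl)
    exact ⟨eY.trans e⟩

/-! ### Whitney twists of graphs without separating pairs -/

/-- No pair of vertices separates the graph. -/
def NoSeparatingPair {V : Type v} (X : SimpleGraph V) : Prop :=
  ∀ (a b : V) (S : Set V),
    (∀ x y, X.Adj x y → x ≠ a → x ≠ b → y ≠ a → y ≠ b → (x ∈ S ↔ y ∈ S)) →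
    ∀ x y, x ≠ a → x ≠ b → y ≠ a → y ≠ b → (x ∈ S ↔ y ∈ S)

theorem NoSeparatingPair.of_iso {V : Type v} {W : Type w} {X : SimpleGraph V}
    {Y : SimpleGraph W} (e : X ≃g Y) (h : NoSeparatingPair X) : NoSeparatingPair Y := by
  intro a b S hS x y hxa hxb hya hyb
  have := h (e.symm a) (e.symm b) (e ⁻¹' S)
    (fun x y hxy h1 h2 h3 h4 => hS (e x) (e y) (e.map_adj_iff.mpr hxy)
      (fun he => h1 (by rw [← he, RelIso.symm_apply_apply]))
      (fun he => h2 (by rw [← he, RelIso.symm_apply_apply]))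
      (fun he => h3 (by rw [← he, RelIso.symm_apply_apply]))
      (fun he => h4 (by rw [← he, RelIso.symm_apply_apply])))
    (e.symm x) (e.symm y) (e.symm.injective.ne hxa) (e.symm.injective.ne hxb)
    (e.symm.injective.ne hya) (e.symm.injective.ne hyb)
  simpa using this

/-- The transposition of two vertices which exhaust a graph is an automorphism. -/
theorem exists_swap_iso {V : Type v} (G : SimpleGraph V) {a b : V} (h : ∀ x, x = a ∨ x = b) :
    ∃ φ : G ≃g G, φ a = b ∧ φ b = a := by
  classical
  refine ⟨⟨Equiv.swap a b, ?_⟩, Equiv.swap_apply_left a b, Equiv.swap_apply_right a b⟩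
  intro x y
  rcases h x with rfl | rfl <;> rcases h y with rfl | rfl <;> simp [SimpleGraph.adj_comm]

/-- A Whitney twist of a graph without separating pair is trivial. -/
theorem DifferByWhitneyTwist.nonempty_iso {V : Type v} {W : Type w} {X : SimpleGraph V}
    {Y : SimpleGraph W} (h : DifferByWhitneyTwist.{u} X Y) (hX : NoSeparatingPair X) :
    Nonempty (X ≃g Y) := by
  obtain ⟨A, B, _, _, G, H, g₁, g₂, h₁, h₂, hg, hh, ⟨eX⟩, ⟨eY⟩⟩ := h
  have ig := vecCons_pair_injective hg
  have ih := vecCons_pair_injective hh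
  suffices Nonempty (glue G H ![g₁, g₂] ![h₁, h₂] ≃g glue G H ![g₁, g₂] ![h₂, h₁]) by
    obtain ⟨e⟩ := this
    exact ⟨(eX.trans e).trans eY.symm⟩
  -- If one side consists of the glued pair alone, swapping the pair is an automorphism of that side
  -- and undoes the twist.
  by_cases hA : ∀ x, x = g₁ ∨ x = g₂
  · obtain ⟨φ, hφ⟩ := exists_swap_iso G hA
    exact nonempty_glue_iso_glue φ (RelIso.refl _) (Equiv.swap 0 1) ig ih
      (fun k => by fin_cases k <;> simp [hφ]) (fun k => by fin_cases k <;> simp)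
  by_cases hB : ∀ x, x = h₁ ∨ x = h₂
  · obtain ⟨ψ, hψ⟩ := exists_swap_iso H hB
    exact nonempty_glue_iso_glue (RelIso.refl _) ψ (Equiv.refl _) ig ih
      (fun k => by fin_cases k <;> simp) (fun k => by fin_cases k <;> simp [hψ])
  push Not at hA hB
  obtain ⟨x, hx1, hx2⟩ := hA
  obtain ⟨y, hy1, hy2⟩ := hB
  exfalso
  have e1 : GlueVertex.inl ![g₁, g₂] ![h₁, h₂] g₁ = GlueVertex.inr ![g₁, g₂] ![h₁, h₂] h₁ :=
    GlueVertex.inl_eq_inr (f := ![g₁, g₂]) (g := ![h₁, h₂]) 0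
  have e2 : GlueVertex.inl ![g₁, g₂] ![h₁, h₂] g₂ = GlueVertex.inr ![g₁, g₂] ![h₁, h₂] h₂ :=
    GlueVertex.inl_eq_inr (f := ![g₁, g₂]) (g := ![h₁, h₂]) 1
  have hmem : ∀ b, GlueVertex.inr ![g₁, g₂] ![h₁, h₂] b ∈
      Set.range (GlueVertex.inl ![g₁, g₂] ![h₁, h₂]) → b = h₁ ∨ b = h₂ := by
    rintro b ⟨a, ha⟩
    obtain ⟨k, -, rfl⟩ := GlueVertex.exists_of_inl_eq_inr ih ha
    fin_cases k <;> simp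
  -- Otherwise the glued pair separates `x` from `y`, with the image of `G` as the separating set.
  have key := hX.of_iso eX (GlueVertex.inl _ _ g₁) (GlueVertex.inl _ _ g₂)
    (Set.range (GlueVertex.inl _ _)) (by
      rintro _ _ ⟨-, ⟨s, t, hst, rfl, rfl⟩ | ⟨s, t, hst, rfl, rfl⟩⟩ h1 h2 h3 h4
      · simp
      · refine iff_of_false (fun h => ?_) (fun h => ?_)
        · rcases hmem _ h with rfl | rfl
          exacts [h1 e1.symm, h2 e2.symm]
        · rcases hmem _ h with rfl | rfl
          exacts [h3 e1.symm, h4 e2.symm])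
    (GlueVertex.inl _ _ x) (GlueVertex.inr _ _ y)
    ((GlueVertex.inl_injective ih).ne hx1) ((GlueVertex.inl_injective ih).ne hx2)
    (fun h => hy1 (GlueVertex.inr_injective ig ih (h.trans e1)))
    (fun h => hy2 (GlueVertex.inr_injective ig ih (h.trans e2)))
  rcases hmem y (key.mp ⟨x, rfl⟩) with h | h
  exacts [hy1 h, hy2 h]

/-- A graph has no separating pair if after removing any two vertices all the others are within
distance two of a common vertex. -/
theorem noSeparatingPair_of_radius_two {V : Type v} {X : SimpleGraph V}
    (h : ∀ a b, ∃ r, ∀ x, x = a ∨ x = b ∨ x = r ∨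
      (r ≠ a ∧ r ≠ b ∧ (X.Adj x r ∨ ∃ z, z ≠ a ∧ z ≠ b ∧ X.Adj x z ∧ X.Adj z r))) :
    NoSeparatingPair X := by
  intro a b S hS
  obtain ⟨r, hr⟩ := h a b
  have key : ∀ x, x ≠ a → x ≠ b → (x ∈ S ↔ r ∈ S) := by
    intro x hxa hxb
    rcases hr x with h | h | rfl | ⟨hra, hrb, h | ⟨z, hza, hzb, h1, h2⟩⟩
    · exact absurd h hxa
    · exact absurd h hxb
    · exact Iff.rfl
    · exact hS x r h hxa hxb hra hrb
    · exact (hS x z h1 hxa hxb hza hzb).trans (hS z r h2 hza hzb hra hrb)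
  intro x y hxa hxb hya hyb
  exact (key x hxa hxb).trans (key y hya hyb).symm

/-! ### A sycamore twist which is not a Whitney twist -/

/-- A vertex with exactly one neighbour in a clique projects to it. -/
theorem edist_clique_eq_of_unique_neighbor {κ W : Type*} {H : SimpleGraph W} {g : κ → W}
    (hg : ∀ k k', k ≠ k' → H.Adj (g k) (g k')) {b : W} {p : κ} (hp : H.Adj b (g p))
    (hb : ∀ k, k ≠ p → b ≠ g k ∧ ¬ H.Adj b (g k)) (k : κ) :
    H.edist b (g k) = H.edist b (g p) + H.edist (g p) (g k) := by
  by_cases hk : k = p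
  · simp [hk]
  · rw [SimpleGraph.edist_eq_one_iff_adj.mpr hp,
      SimpleGraph.edist_eq_one_iff_adj.mpr (hg p k (Ne.symm hk)), one_add_one_eq_two,
      SimpleGraph.edist_eq_two_iff]
    exact ⟨(hb k hk).1, (hb k hk).2, g p, hp, (hg p k (Ne.symm hk)).symm⟩

/-- The graph on `Fin n` with the edges in a list. -/
def listGraph (n : ℕ) (l : List (Fin n × Fin n)) : SimpleGraph (Fin n) where
  Adj x y := x ≠ y ∧ ((x, y) ∈ l ∨ (y, x) ∈ l)
  symm := ⟨fun _ _ h => ⟨h.1.symm, h.2.symm⟩⟩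
  loopless := ⟨fun _ h => h.1 rfl⟩

instance (n : ℕ) (l : List (Fin n × Fin n)) : DecidableRel (listGraph n l).Adj :=
  fun x y => inferInstanceAs (Decidable (x ≠ y ∧ ((x, y) ∈ l ∨ (y, x) ∈ l)))

/-- A triangle `0, 1, 2` with an attached edge `34`. -/
def exampleG : SimpleGraph (Fin 5) :=
  listGraph 5 [(0, 1), (0, 2), (1, 2), (3, 4), (3, 0), (3, 1), (4, 0), (4, 2)]

/-- A triangle `0, 1, 2` with an attached complete graph `3, 4, 5, 6`. -/
def exampleH : SimpleGraph (Fin 7) :=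
  listGraph 7 [(0, 1), (0, 2), (1, 2), (3, 0), (4, 0), (5, 1), (6, 2),
    (3, 4), (3, 5), (3, 6), (4, 5), (4, 6), (5, 6)]

/-- The triangles of `exampleG` and `exampleH` glued by the identity. -/
def exampleX : SimpleGraph (Fin 9) :=
  listGraph 9 [(0, 1), (0, 2), (1, 2), (3, 4), (3, 0), (3, 1), (4, 0), (4, 2),
    (5, 0), (6, 0), (7, 1), (8, 2), (5, 6), (5, 7), (5, 8), (6, 7), (6, 8), (7, 8)]

/-- The triangles of `exampleG` and `exampleH` glued by exchanging `0` and `1`. -/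
def exampleY : SimpleGraph (Fin 9) :=
  listGraph 9 [(0, 1), (0, 2), (1, 2), (3, 4), (3, 0), (3, 1), (4, 0), (4, 2),
    (5, 1), (6, 1), (7, 0), (8, 2), (5, 6), (5, 7), (5, 8), (6, 7), (6, 8), (7, 8)]

instance : DecidableRel exampleG.Adj := inferInstanceAs (DecidableRel (listGraph _ _).Adj)
instance : DecidableRel exampleH.Adj := inferInstanceAs (DecidableRel (listGraph _ _).Adj)
instance : DecidableRel exampleX.Adj := inferInstanceAs (DecidableRel (listGraph _ _).Adj)
instance : DecidableRel exampleY.Adj := inferInstanceAs (DecidableRel (listGraph _ _).Adj)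

set_option maxRecDepth 10000 in
set_option maxHeartbeats 1000000 in
theorem differBySycamoreTwist_example : DifferBySycamoreTwist.{0} exampleX exampleY := by
  have hg : ∀ k k' : Fin 3, k ≠ k' → exampleH.Adj (![0, 1, 2] k) (![0, 1, 2] k') := by decide
  have hnbr : ∀ b : Fin 7, (∃ p : Fin 3, b = ![0, 1, 2] p) ∨ ∃ p : Fin 3,
      exampleH.Adj b (![0, 1, 2] p) ∧
        ∀ k, k ≠ p → b ≠ ![0, 1, 2] k ∧ ¬ exampleH.Adj b (![0, 1, 2] k) := by decide
  refine ⟨cliqueTwist (G := exampleG) (H := exampleH) (![0, 1, 2] : Fin 3 → Fin 5)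
    (![0, 1, 2] : Fin 3 → Fin 7) (by decide) hg (Equiv.swap 0 1),
    isSycamore_cliqueTwist fun b => Or.inl ?_, ?_, ?_⟩
  -- Every vertex projects: to itself in the triangle, else to its unique neighbour there.
  -- Equidistance is never invoked.
  · rcases hnbr b with ⟨p, rfl⟩ | ⟨p, hp, hb⟩
    · exact ⟨p, SimpleGraph.Reachable.refl _, fun k => by simp⟩
    · exact ⟨p, hp.reachable, edist_clique_eq_of_unique_neighbor hg hp hb⟩
  · exact nonempty_iso_glue (G := exampleG) (H := exampleH)
      (f := (![0, 1, 2] : Fin 3 → Fin 5))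
      (g := (![0, 1, 2] : Fin 3 → Fin 7))
      (![0, 1, 2, 3, 4] : Fin 5 → Fin 9) (![0, 1, 2, 5, 6, 7, 8] : Fin 7 → Fin 9)
      (by decide) (by decide) (by decide) (by decide) (by decide) (by decide)
  · exact nonempty_iso_glue (G := exampleG) (H := exampleH)
      (f := (![0, 1, 2] : Fin 3 → Fin 5))
      (g := fun k => (![0, 1, 2] : Fin 3 → Fin 7) (Equiv.swap 0 1 k))
      -- The first two values are exchanged to cancel the swap in `g`.
      (![0, 1, 2, 3, 4] : Fin 5 → Fin 9) (![1, 0, 2, 5, 6, 7, 8] : Fin 7 → Fin 9)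
      (by decide) (by decide) (by decide) (by decide) (by decide) (by decide)

set_option maxRecDepth 10000 in
set_option maxHeartbeats 1000000 in
theorem noSeparatingPair_exampleX : NoSeparatingPair exampleX :=
  noSeparatingPair_of_radius_two (by decide)

/-- On each side the triangle vertices `0, 1, 2` have degrees `4, 3, 3`, and gluing counts two
triangle edges once. The identity matches the two fours, giving `4 + 4 - 2 = 6`; after the swap the
largest degree is `5`. -/
theorem isEmpty_exampleX_iso_exampleY : IsEmpty (exampleX ≃g exampleY) := by
  refine ⟨fun e => ?_⟩
  have h1 : exampleX.degree 0 = 6 := by decide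
  have h2 : ∀ x, exampleY.degree x ≠ 6 := by decide
  exact h2 (e 0) ((e.degree_eq 0).trans h1)

end GraphTwist

theorem theorem6p5 :
    (∀ (V : Type v) (W : Type w) [Fintype V] [Fintype W] (X : SimpleGraph V) (Y : SimpleGraph W),
      GraphTwist.DifferBySycamoreTwist.{u} X Y →
        GraphTwist.magnitude X = GraphTwist.magnitude Y) ∧
    (∀ (V : Type v) (W : Type w) (X : SimpleGraph V) (Y : SimpleGraph W),
      GraphTwist.DifferByAdjacentWhitneyTwist.{u} X Y →
        GraphTwist.DifferBySycamoreTwist.{u} X Y) ∧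
    (∃ (n : ℕ) (X Y : SimpleGraph (Fin n)),
      GraphTwist.DifferBySycamoreTwist.{0} X Y ∧
        ¬ GraphTwist.DifferByWhitneyTwist.{0} X Y ∧ IsEmpty (X ≃g Y)) := by
  refine ⟨fun V W _ _ X Y h => h.magnitude_eq, fun V W X Y h => h.differBySycamoreTwist,
    9, GraphTwist.exampleX, GraphTwist.exampleY, GraphTwist.differBySycamoreTwist_example,
    fun h => ?_, GraphTwist.isEmpty_exampleX_iso_exampleY⟩
  obtain ⟨e⟩ := h.nonempty_iso GraphTwist.noSeparatingPair_exampleX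
  exact GraphTwist.isEmpty_exampleX_iso_exampleY.false e
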